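/- For every constant $\varepsilon>0$ there is a constant $C$, depending only on $\varepsilon$, such that for every $n\ge 1$ and every finite set $Y$ (endowed with an arbitrary abelian group structure, for instance bitwise XOR on $\{0,1\}^m$ or addition modulo $|Y|$) there is a quantum query algorithm which makes at most $C\,n^{2/3}$ queries and which, for every function $f:[n]\to Y$ given by an oracle, with probability at least $1-\varepsilon$ outputs a pair of distinct elements $i,j\in[n]$ with $f(i)=f(j)$ if there is such a pair, and rejects otherwise. In other words, Element Distinctness can be solved with high probability in quantum query complexity $O(n^{2/3})$, uniformly in the range of $f$. Here a quantum query algorithm with $T$ queries acts on $\mathbb{C}^{[n]}\otimes\mathbb{C}^{Y}\otimes\mathbb{C}^{W}$ with a finite work register $W$; it starts in a fixed basis state, applies $U_T O_f U_{T-1} O_f\cdots U_1 O_f U_0$, where $U_0,\dots,U_T$ are unitaries that do not depend on $f$ and the query operator is $O_f:|i\rangle|a\rangle|w\rangle\mapsto|i\rangle|a+f(i)\rangle|w\rangle$, measures in the standard basis, and determines its output from the outcome by a fixed function that does not depend on $f$. -/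

import Mathlib

/-- A quantum query algorithm with oracle access to an unknown function `f : Fin n → Y` and with
classical outputs in `Out`. There are three registers: the query register (`Fin n`), the answer
register (`Y`) and a finite work register (`Work`). Nothing in this structure depends on `f`. -/
structure QueryAlgorithm (n : ℕ) (Y : Type) [Fintype Y] (Out : Type) where
  /-- The index set of the basis states of the work register. -/
  Work : Type
  [fintypeWork : Fintype Work]
  /-- The number of oracle queries. -/
  queries : ℕ
  /-- The basis state in which the computation starts. -/
  init : Fin n × Y × Work
  /-- `unitary 0` is applied before the first query and `unitary t` right after the `t`-th query,
  for `1 ≤ t ≤ queries`; the values at larger `t` are not used. -/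
  unitary : ℕ → (EuclideanSpace ℂ (Fin n × Y × Work) ≃ₗᵢ[ℂ] EuclideanSpace ℂ (Fin n × Y × Work))
  /-- The output, as a function of the outcome of the final measurement in the standard basis. -/
  output : Fin n × Y × Work → Out

attribute [instance] QueryAlgorithm.fintypeWork

/-- The permutation `(i, a, w) ↦ (i, a + f i, w)` of the basis states. -/
def oraclePerm {n : ℕ} {Y : Type} [AddCommGroup Y] (W : Type) (f : Fin n → Y) :
    Equiv.Perm (Fin n × Y × W) where
  toFun b := (b.1, b.2.1 + f b.1, b.2.2)
  invFun b := (b.1, b.2.1 - f b.1, b.2.2)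
  left_inv b := by simp
  right_inv b := by simp

/-- One oracle query: the unitary `|i⟩|a⟩|w⟩ ↦ |i⟩|a + f i⟩|w⟩`. -/
noncomputable def oracleQuery {n : ℕ} {Y : Type} [AddCommGroup Y] [Fintype Y]
    (W : Type) [Fintype W] (f : Fin n → Y) :
    EuclideanSpace ℂ (Fin n × Y × W) ≃ₗᵢ[ℂ] EuclideanSpace ℂ (Fin n × Y × W) :=
  LinearIsometryEquiv.piLpCongrLeft 2 ℂ ℂ (oraclePerm W f)

namespace QueryAlgorithm

variable {n : ℕ} {Y : Type} [AddCommGroup Y] [Fintype Y] {Out : Type}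

open Classical in
/-- The state after `t` queries on the input `f`, i.e. `U_t O_f U_{t-1} O_f ⋯ O_f U_0 |init⟩`. -/
noncomputable def stateAfter (A : QueryAlgorithm n Y Out) (f : Fin n → Y) :
    ℕ → EuclideanSpace ℂ (Fin n × Y × A.Work)
  | 0 => A.unitary 0 (EuclideanSpace.single A.init 1)
  | t + 1 => A.unitary (t + 1) (oracleQuery A.Work f (A.stateAfter f t))

/-- The state that is measured at the end. -/
noncomputable def finalState (A : QueryAlgorithm n Y Out) (f : Fin n → Y) :
    EuclideanSpace ℂ (Fin n × Y × A.Work) :=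
  A.stateAfter f A.queries

open Classical in
/-- The probability that, on the input `f`, the measured output satisfies `valid`. -/
noncomputable def outputProb (A : QueryAlgorithm n Y Out) (f : Fin n → Y) (valid : Out → Prop) :
    ℝ :=
  ∑ b : Fin n × Y × A.Work with valid (A.output b), ‖A.finalState f b‖ ^ 2

end QueryAlgorithm

/-- The correct answers of Element Distinctness on the input `f`: a pair of distinct elements with
the same value under `f`, or rejection (`none`) when there is no such pair. -/
def IsElementDistinctnessAnswer {n : ℕ} {Y : Type} (f : Fin n → Y) :
    Option (Fin n × Fin n) → Prop
  | some (i, j) => i ≠ j ∧ f i = f j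
  | none => ∀ i j : Fin n, i ≠ j → f i ≠ f j

/-- `A` solves Element Distinctness with error probability at most `ε` on every input. -/
def SolvesElementDistinctness {n : ℕ} {Y : Type} [AddCommGroup Y] [Fintype Y]
    (A : QueryAlgorithm n Y (Option (Fin n × Fin n))) (ε : ℝ) : Prop :=
  ∀ f : Fin n → Y, 1 - ε ≤ A.outputProb f (IsElementDistinctnessAnswer f)

/-! An input-independent unitary carries one family of vectors to another as soon as their Gram
matrices agree. Hence an algorithm is obtained from ideal states whose Gram matrix after each query
equals that of the next ideal states (`exists_queryAlgorithm_of_inner_eq`). Such states come from a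
feasible solution of an adversary bound for state conversion: vectors `u f j`, `v f j` whose
products, summed over the positions where `f` and `g` differ and over both orders of `f` and `g`,
give one minus the Gram matrix of the target states. If their total squared norm is at most `L`,
then `K` queries leave error `4 * L / K` (`exists_queryAlgorithm_of_adversary_pair`). The solution
imitates a quantum walk. A random set `A`, containing each position with probability `p`, is loaded
at cost of order `n * p`; adding a colliding pair in two queries costs at most `2 / p + 1 / p ^ 2`.
The choice `p = n ^ (-1/3)` balances these to order `n ^ (2/3)`. The number `N` of ordered colliding
pairs is unknown. With `a`, `b` its square roots for two inputs, the weight `a / (a + b)` removes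
this difficulty: the two orders add up to `1`, and the terms `M / (a * (a + b))` and `M / (b * (a +
b))` to `M / (a * b)`, the Gram matrix of uniform superpositions of recorded pairs. When both counts
vanish the weight is zero and the target is the recorded set alone. -/

/-! ### From Gram matrices to query algorithms -/

theorem exists_linearIsometryEquiv_of_inner_eq {V X : Type*} [NormedAddCommGroup V]
    [InnerProductSpace ℂ V] [FiniteDimensional ℂ V] (a b : X → V)
    (h : ∀ x y, inner ℂ (a x) (a y) = inner ℂ (b x) (b y)) :
    ∃ U : V ≃ₗᵢ[ℂ] V, ∀ x, U (a x) = b x := by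
  let F := Finsupp.linearCombination ℂ a
  let G := Finsupp.linearCombination ℂ b
  have hnorm : ∀ c, ‖F c‖ = ‖G c‖ := by
    intro c
    have : inner ℂ (F c) (F c) = inner ℂ (G c) (G c) := by
      simp only [F, G, Finsupp.linearCombination_apply, Finsupp.sum, sum_inner, inner_sum,
        inner_smul_left, inner_smul_right, h]
    rw [inner_self_eq_norm_sq_to_K, inner_self_eq_norm_sq_to_K] at this
    have h2 : ‖F c‖ ^ 2 = ‖G c‖ ^ 2 := by exact_mod_cast this
    exact (sq_eq_sq₀ (norm_nonneg _) (norm_nonneg _)).1 h2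
  -- Any linear section of `F` will do: by `hnorm`, `G` vanishes on the kernel of `F`, so `G ∘ r`
  -- does not depend on the choice.
  obtain ⟨r, hr⟩ := F.rangeRestrict.exists_rightInverse_of_surjective F.range_rangeRestrict
  have hFr : ∀ s, F (r s) = s := fun s => congrArg Subtype.val (LinearMap.congr_fun hr s)
  let I : LinearMap.range F →ₗᵢ[ℂ] V :=
    { toLinearMap := G ∘ₗ r
      norm_map' := fun s => by
        change ‖G (r s)‖ = ‖s‖
        rw [← hnorm, hFr]; rfl }
  refine ⟨I.extend.toLinearIsometryEquiv rfl, fun x => ?_⟩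
  have hx : F (Finsupp.single x 1) = a x := by simp [F]
  have hy : G (Finsupp.single x 1) = b x := by simp [G]
  have h1 : I.extend (a x) = G (r ⟨a x, ⟨_, hx⟩⟩) := I.extend_apply ⟨a x, ⟨_, hx⟩⟩
  change I.extend (a x) = b x
  rw [h1, ← hy, ← sub_eq_zero, ← map_sub, ← norm_eq_zero, ← hnorm, map_sub, hFr, hx, sub_self,
    norm_zero]

-- The algorithm starts from `base` instead of the ideal state `Φ 0 f`. Unitaries and queries
-- preserve distances, so this initial discrepancy never grows; together with the bad mass of the
-- ideal final state it gives error `2 * δ + 2 * δ`.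
open Classical in
theorem exists_queryAlgorithm_of_inner_eq {n : ℕ} {Y : Type} [AddCommGroup Y] [Fintype Y]
    {Out W : Type} [Fintype W] (K : ℕ) (init : Fin n × Y × W) (out : Fin n × Y × W → Out)
    (base : EuclideanSpace ℂ (Fin n × Y × W)) (hbase : ‖base‖ = 1)
    (Φ : ℕ → (Fin n → Y) → EuclideanSpace ℂ (Fin n × Y × W))
    (hΦ : ∀ t < K, ∀ f g, inner ℂ (oracleQuery W f (Φ t f)) (oracleQuery W g (Φ t g)) =
      inner ℂ (Φ (t + 1) f) (Φ (t + 1) g)) :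
    ∃ A : QueryAlgorithm n Y Out, A.queries = K ∧ ∀ f (valid : Out → Prop) (δ : ℝ),
      ‖base - Φ 0 f‖ ^ 2 ≤ δ → ∑ b with ¬ valid (out b), ‖Φ K f b‖ ^ 2 ≤ δ →
      1 - 4 * δ ≤ A.outputProb f valid := by
  obtain ⟨U₀, hU₀⟩ := exists_linearIsometryEquiv_of_inner_eq
    (fun _ : Unit => (EuclideanSpace.single init 1 : EuclideanSpace ℂ (Fin n × Y × W)))
    (fun _ => base) (by simp [inner_self_eq_norm_sq_to_K, hbase])
  have hU : ∀ t, ∃ U : EuclideanSpace ℂ (Fin n × Y × W) ≃ₗᵢ[ℂ] EuclideanSpace ℂ (Fin n × Y × W),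
      t < K → ∀ f, U (oracleQuery W f (Φ t f)) = Φ (t + 1) f := by
    intro t
    by_cases ht : t < K
    · obtain ⟨U, hU⟩ := exists_linearIsometryEquiv_of_inner_eq
        (fun f => oracleQuery W f (Φ t f)) (fun f => Φ (t + 1) f) (hΦ t ht)
      exact ⟨U, fun _ => hU⟩
    · exact ⟨LinearIsometryEquiv.refl ℂ _, fun h => absurd h ht⟩
  choose U hU using hU
  let A : QueryAlgorithm n Y Out :=
    { Work := W
      queries := K
      init := init
      unitary := fun t => match t with
        | 0 => U₀
        | t + 1 => U t
      output := out }
  refine ⟨A, rfl, fun f valid δ h0 hK => ?_⟩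
  have hdist : ∀ t ≤ K, ‖A.stateAfter f t - Φ t f‖ = ‖base - Φ 0 f‖ := by
    intro t
    induction t with
    | zero =>
      intro _
      have : A.stateAfter f 0 = base := by
        rw [← hU₀ ()]
        simp [QueryAlgorithm.stateAfter, A]
      rw [this]
    | succ t ih =>
      intro ht
      have : A.stateAfter f (t + 1) = U t (oracleQuery W f (A.stateAfter f t)) := rfl
      rw [this, ← hU t ht f, ← map_sub, ← map_sub, LinearIsometryEquiv.norm_map,
        LinearIsometryEquiv.norm_map, ih (by omega)]
  have hnorm : ∀ t, ‖A.stateAfter f t‖ = 1 := by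
    intro t
    induction t with
    | zero =>
      have : A.stateAfter f 0 = U₀ (EuclideanSpace.single init 1) := by
        simp [QueryAlgorithm.stateAfter, A]
      rw [this, LinearIsometryEquiv.norm_map]; simp
    | succ t ih =>
      have : A.stateAfter f (t + 1) = U t (oracleQuery W f (A.stateAfter f t)) := rfl
      rw [this, LinearIsometryEquiv.norm_map, LinearIsometryEquiv.norm_map, ih]
  set ψ : EuclideanSpace ℂ (Fin n × Y × W) := A.stateAfter f K with hψ
  have hout : A.outputProb f valid = ∑ b with valid (out b), ‖ψ b‖ ^ 2 := by
    unfold QueryAlgorithm.outputProb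
    exact Finset.sum_congr (by ext; simp [A]) fun _ _ => rfl
  have htotal : ∑ b with valid (out b), ‖ψ b‖ ^ 2 + ∑ b with ¬ valid (out b), ‖ψ b‖ ^ 2 = 1 := by
    rw [Finset.sum_filter_add_sum_filter_not, ← EuclideanSpace.norm_sq_eq, hψ, hnorm, one_pow]
  have hdiff : ∑ b with ¬ valid (out b), ‖ψ b - Φ K f b‖ ^ 2 ≤ δ := by
    calc _ ≤ ∑ b, ‖ψ b - Φ K f b‖ ^ 2 :=
          Finset.sum_le_univ_sum_of_nonneg fun _ => sq_nonneg _
      _ = ‖ψ - Φ K f‖ ^ 2 := by rw [EuclideanSpace.norm_sq_eq]; rfl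
      _ ≤ δ := by rw [hψ, hdist K le_rfl]; exact h0
  have hbad : ∑ b with ¬ valid (out b), ‖ψ b‖ ^ 2 ≤
      ∑ b with ¬ valid (out b), (2 * ‖ψ b - Φ K f b‖ ^ 2 + 2 * ‖Φ K f b‖ ^ 2) := by
    refine Finset.sum_le_sum fun b _ => ?_
    have h1 : ‖ψ b‖ ≤ ‖ψ b - Φ K f b‖ + ‖Φ K f b‖ := by
      simpa using norm_add_le (ψ b - Φ K f b) (Φ K f b)
    nlinarith [norm_nonneg (ψ b), norm_nonneg (ψ b - Φ K f b), norm_nonneg (Φ K f b),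
      sq_nonneg (‖ψ b - Φ K f b‖ - ‖Φ K f b‖)]
  rw [Finset.sum_add_distrib, ← Finset.mul_sum, ← Finset.mul_sum] at hbad
  rw [hout]
  linarith

/-! ### The adversary upper bound by catalysis -/

/-- The vector of `EuclideanSpace ℂ ι` with the given real coordinates. -/
noncomputable def realVec {ι : Type*} (v : ι → ℝ) : EuclideanSpace ℂ ι :=
  WithLp.toLp 2 fun i => (v i : ℂ)

theorem inner_realVec {ι : Type*} [Fintype ι] (v w : ι → ℝ) :
    inner ℂ (realVec v) (realVec w) = ((∑ i, v i * w i : ℝ) : ℂ) := by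
  simp [realVec, PiLp.inner_apply, mul_comm]

theorem norm_sq_realVec {ι : Type*} [Fintype ι] (v : ι → ℝ) :
    ‖realVec v‖ ^ 2 = ∑ i, v i ^ 2 := by
  simp [realVec, EuclideanSpace.norm_sq_eq]

theorem oracleQuery_realVec {n : ℕ} {Y W : Type} [AddCommGroup Y] [Fintype Y] [Fintype W]
    (f : Fin n → Y) (v : Fin n × Y × W → ℝ) :
    oracleQuery W f (realVec v) = realVec fun b => v (b.1, b.2.1 - f b.1, b.2.2) := by
  ext b
  simp [oracleQuery, realVec, LinearIsometryEquiv.piLpCongrLeft_apply, oraclePerm]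

open Classical in
/-- The coordinates of the states used in `exists_queryAlgorithm_of_adversary`. The public part,
with amplitudes `l` and `τ`, is uniform on the query and answer registers; the catalyst, with
amplitudes `p` and `m`, is located at the values `c i` and `e i` of the answer register. -/
noncomputable def catalystState {n : ℕ} {Y S D : Type} [Fintype Y] (l : ℝ) (τ : S → ℝ)
    (p m : Fin n → D → ℝ) (c e : Fin n → Y) : Fin n × Y × (Option S ⊕ (D ⊕ D)) → ℝ
  | (_, _, Sum.inl none) => l / √(n * Fintype.card Y)
  | (_, _, Sum.inl (some s)) => τ s / √(n * Fintype.card Y)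
  | (i, a, Sum.inr (Sum.inl d)) => if a = c i then p i d else 0
  | (i, a, Sum.inr (Sum.inr d)) => if a = e i then m i d else 0

-- Catalyst vectors of two inputs interact at `i` only if they sit at the same answer value. A query
-- moves these values, and thereby changes the Gram matrix exactly at the positions where the inputs
-- differ.
open Classical in
theorem sum_catalystState_mul {n : ℕ} {Y S D : Type} [Fintype Y] [Nonempty Y] [Fintype S]
    [Fintype D] (hn : 1 ≤ n) (l l' : ℝ) (τ τ' : S → ℝ) (p m p' m' : Fin n → D → ℝ)
    (c e c' e' : Fin n → Y) :
    ∑ b, catalystState l τ p m c e b * catalystState l' τ' p' m' c' e' b =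
      l * l' + ∑ s, τ s * τ' s + ∑ i, (if c i = c' i then ∑ d, p i d * p' i d else 0) +
        ∑ i, (if e i = e' i then ∑ d, m i d * m' i d else 0) := by
  have hY : (0 : ℝ) < n * Fintype.card Y := by
    have : 0 < Fintype.card Y := Fintype.card_pos
    have : 0 < n := hn
    positivity
  have hdiv : ∀ x y : ℝ, x / √(n * Fintype.card Y) * (y / √(n * Fintype.card Y)) =
      x * y / (n * Fintype.card Y) := fun x y => by
    rw [div_mul_div_comm, Real.mul_self_sqrt hY.le]
  have hdelta : ∀ (u v : Y) (q q' : D → ℝ),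
      ∑ a, ∑ d, (if a = u then q d else 0) * (if a = v then q' d else 0) =
        if u = v then ∑ d, q d * q' d else 0 := by
    intro u v q q'
    rw [Finset.sum_eq_single u]
    · by_cases h : u = v <;> simp [h]
    · intro a _ ha; simp [ha]
    · simp
  simp only [Fintype.sum_prod_type, Fintype.sum_sum_type, Fintype.sum_option, catalystState, hdiv,
    Finset.sum_add_distrib, hdelta, ← Finset.sum_div]
  simp only [Finset.sum_const, Finset.card_univ, Fintype.card_fin, nsmul_eq_mul]
  field_simp
  ring

open Classical in
/-- The adversary upper bound for state conversion: vectors that account for the Gram matrix of the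
target vectors `τ` and have squared norm at most `L` give an algorithm with `K` queries and error
probability at most `4 * L / K`. -/
theorem exists_queryAlgorithm_of_adversary {n : ℕ} {Y Out S D : Type} [AddCommGroup Y] [Fintype Y]
    [Fintype S] [Fintype D] (hn : 1 ≤ n) (out₀ : Out) (out : S → Out) (τ : (Fin n → Y) → S → ℝ)
    (p m : (Fin n → Y) → Fin n → D → ℝ) (L : ℝ)
    (h : ∀ f g, ∑ s, τ f s * τ g s = 1 - ∑ j, if f j = g j then 0 else
      (∑ d, p f j d * p g j d - ∑ d, m f j d * m g j d))
    (hL : ∀ f, ∑ j, ∑ d, (p f j d ^ 2 + m f j d ^ 2) ≤ L) (K : ℕ) (hK : 0 < K) :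
    ∃ A : QueryAlgorithm n Y Out, A.queries = K ∧ ∀ f (valid : Out → Prop),
      (∀ s, ¬ valid (out s) → τ f s = 0) → 1 - 4 * (L / K) ≤ A.outputProb f valid := by
  have hK' : (0 : ℝ) < K := by exact_mod_cast hK
  have hκ : ∀ x y : ℝ, x / √K * (y / √K) = x * y / K := fun x y => by
    rw [div_mul_div_comm, Real.mul_self_sqrt hK'.le]
  let W := Option S ⊕ (D ⊕ D)
  -- A query moves the `p` part from `0` to `f` and the `m` part from `-f` to `0`. So the `p`
  -- products lose the positions with `f i ≠ g i` and the `m` products gain them. The scaling by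
  -- `√K` makes this change a `K`-th of the total, matching the transfer of weight `1 / K` from the
  -- start to `τ`.
  let φ : ℕ → (Fin n → Y) → Fin n × Y × W → ℝ := fun t f =>
    catalystState √(1 - t / K) (fun s => √(t / K) * τ f s) (fun i d => p f i d / √K)
      (fun i d => m f i d / √K) 0 (-f)
  let base : Fin n × Y × W → ℝ := catalystState 1 0 0 0 0 0
  have hbase : ‖realVec base‖ = 1 := by
    rw [← sq_eq_sq₀ (norm_nonneg _) zero_le_one, norm_sq_realVec]
    simp only [sq, base]
    rw [sum_catalystState_mul hn]
    simp
  have hquery : ∀ t f, oracleQuery W f (realVec (φ t f)) = realVec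
      (catalystState √(1 - t / K) (fun s => √(t / K) * τ f s) (fun i d => p f i d / √K)
        (fun i d => m f i d / √K) f 0 : Fin n × Y × W → ℝ) := by
    intro t f
    rw [oracleQuery_realVec]
    congr 1
    funext ⟨i, a, w⟩
    rcases w with (_ | s) | d | d <;>
      simp [φ, catalystState, sub_eq_iff_eq_add]
  obtain ⟨A, hA, hout⟩ := exists_queryAlgorithm_of_inner_eq K
    ((⟨0, hn⟩, 0, Sum.inl none) : Fin n × Y × W)
    (fun b => match b.2.2 with
      | Sum.inl (some s) => out s
      | _ => out₀)
    (realVec base) hbase (fun t f => realVec (φ t f)) (by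
      intro t ht f g
      have ht' : (t : ℝ) + 1 ≤ K := by exact_mod_cast ht
      rw [hquery, hquery, inner_realVec, inner_realVec]
      simp only [φ]
      rw [sum_catalystState_mul hn, sum_catalystState_mul hn]
      have h1 : ∀ r : ℝ, 0 ≤ r → ∑ s, √r * τ f s * (√r * τ g s) = r * ∑ s, τ f s * τ g s := by
        intro r hr
        rw [Finset.mul_sum]
        refine Finset.sum_congr rfl fun s _ => ?_
        rw [mul_mul_mul_comm, Real.mul_self_sqrt hr]
      have hsplit : ∀ q : Fin n → ℝ, ∑ i, q i =
          ∑ i, (if f i = g i then q i else 0) + ∑ i, if f i = g i then 0 else q i := by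
        intro q
        rw [← Finset.sum_add_distrib]
        exact Finset.sum_congr rfl fun i _ => by split_ifs <;> simp
      have h2 : (∑ j, if f j = g j then 0 else
          (∑ d, p f j d * p g j d - ∑ d, m f j d * m g j d)) =
          ∑ j, (if f j = g j then 0 else ∑ d, p f j d * p g j d) -
            ∑ j, (if f j = g j then 0 else ∑ d, m f j d * m g j d) := by
        rw [← Finset.sum_sub_distrib]
        exact Finset.sum_congr rfl fun i _ => by split_ifs <;> simp
      have hite : ∀ (P : Prop) (x : ℝ), (if P then x / K else 0) = (if P then x else 0) / K :=
        fun P x => by split_ifs <;> simp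
      have hp := hsplit fun i => ∑ d, p f i d * p g i d
      have hm := hsplit fun i => ∑ d, m f i d * m g i d
      have hfg := h f g
      rw [h2] at hfg
      congr 1
      rw [h1 _ (by positivity), h1 _ (by positivity), Real.mul_self_sqrt, Real.mul_self_sqrt]
      · simp only [hκ, Pi.zero_apply, Pi.neg_apply, neg_inj, if_true, ← Finset.sum_div, hite]
        rw [hp, hm, hfg]
        push_cast
        field_simp
        ring
      · rw [sub_nonneg, div_le_one hK']; exact_mod_cast ht
      · rw [sub_nonneg, div_le_one hK']; linarith)
  refine ⟨A, hA, fun f valid hvalid => hout f valid (L / K) ?_ ?_⟩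
  · have h0 : realVec base - realVec (φ 0 f) = realVec (catalystState 0 0
        (fun i d => -(p f i d / √K)) (fun i d => -(m f i d / √K)) 0 (-f) :
          Fin n × Y × W → ℝ) := by
      ext ⟨i, a, w⟩
      rcases w with (_ | s) | d | d
      · simp [realVec, base, φ, catalystState]
      · simp [realVec, base, φ, catalystState]
      · simp only [realVec, base, φ, catalystState, PiLp.sub_apply]
        split_ifs <;> simp
      · simp only [realVec, base, φ, catalystState, PiLp.sub_apply]
        split_ifs <;> simp
    rw [h0, norm_sq_realVec]
    simp only [sq]
    rw [sum_catalystState_mul hn]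
    simp only [neg_mul_neg, hκ, if_true, ← Finset.sum_div]
    simp only [Pi.zero_apply, mul_zero, Finset.sum_const_zero, zero_add]
    rw [← add_div, ← Finset.sum_add_distrib]
    refine div_le_div_of_nonneg_right (le_trans (le_of_eq ?_) (hL f)) hK'.le
    refine Finset.sum_congr rfl fun i _ => ?_
    rw [← Finset.sum_add_distrib]
    exact Finset.sum_congr rfl fun d _ => by ring
  · have hle : ∀ b : Fin n × Y × W, ¬ valid (match b.2.2 with
        | Sum.inl (some s) => out s
        | _ => out₀) → ‖realVec (φ K f) b‖ ^ 2 ≤ (catalystState 0 0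
        (fun i d => p f i d / √K) (fun i d => m f i d / √K) 0 (-f) b) ^ 2 := by
      rintro ⟨i, a, w⟩ hb
      rcases w with (_ | s) | d | d
      · simp [realVec, φ, catalystState, hK.ne']
      · simp [realVec, φ, catalystState, hvalid s hb]
      · simp [realVec, φ, catalystState]
      · simp [realVec, φ, catalystState]
    refine (Finset.sum_le_sum fun b hb => hle b (Finset.mem_filter.1 hb).2).trans
      ((Finset.sum_le_univ_sum_of_nonneg fun _ => sq_nonneg _).trans ?_)
    simp only [sq]
    rw [sum_catalystState_mul hn]
    simp only [hκ, if_true, ← Finset.sum_div]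
    simp only [Pi.zero_apply, mul_zero, Finset.sum_const_zero, zero_add]
    rw [← add_div, ← Finset.sum_add_distrib]
    refine div_le_div_of_nonneg_right (le_trans (le_of_eq ?_) (hL f)) hK'.le
    refine Finset.sum_congr rfl fun i _ => ?_
    rw [← Finset.sum_add_distrib]
    exact Finset.sum_congr rfl fun d _ => by ring

-- Polarization: with `p` and `m` the sum and difference of `u` and `v`, divided by `√2`, `p * p' -
-- m * m'` equals `u * v' + v * u'`.
open Classical in
theorem exists_queryAlgorithm_of_adversary_pair {n : ℕ} {Y Out S D : Type} [AddCommGroup Y]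
    [Fintype Y] [Fintype S] [Fintype D] (hn : 1 ≤ n) (out₀ : Out) (out : S → Out)
    (τ : (Fin n → Y) → S → ℝ) (u v : (Fin n → Y) → Fin n → D → ℝ) (L : ℝ)
    (h : ∀ f g, ∑ s, τ f s * τ g s = 1 - ((∑ j, if f j = g j then 0 else ∑ d, u f j d * v g j d) +
      ∑ j, if g j = f j then 0 else ∑ d, u g j d * v f j d))
    (hL : ∀ f, ∑ j, ∑ d, u f j d ^ 2 + ∑ j, ∑ d, v f j d ^ 2 ≤ L) (K : ℕ) (hK : 0 < K) :
    ∃ A : QueryAlgorithm n Y Out, A.queries = K ∧ ∀ f (valid : Out → Prop),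
      (∀ s, ¬ valid (out s) → τ f s = 0) → 1 - 4 * (L / K) ≤ A.outputProb f valid := by
  have h2 : √(2 : ℝ) * √2 = 2 := Real.mul_self_sqrt zero_le_two
  have hdiv : ∀ x y : ℝ, x / √2 * (y / √2) = x * y / 2 := fun x y => by
    rw [div_mul_div_comm, h2]
  refine exists_queryAlgorithm_of_adversary hn out₀ out τ
    (fun f j d => (u f j d + v f j d) / √2) (fun f j d => (u f j d - v f j d) / √2) L
    (fun f g => ?_) (fun f => le_trans (le_of_eq ?_) (hL f)) K hK
  · rw [h f g, ← Finset.sum_add_distrib]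
    congr 1
    refine Finset.sum_congr rfl fun j _ => ?_
    simp only [eq_comm (a := g j)]
    split_ifs
    · simp
    · rw [← Finset.sum_add_distrib, ← Finset.sum_sub_distrib]
      refine Finset.sum_congr rfl fun d _ => ?_
      rw [hdiv, hdiv]; ring
  · simp only [← Finset.sum_add_distrib]
    refine Finset.sum_congr rfl fun j _ => Finset.sum_congr rfl fun d _ => ?_
    rw [sq, sq, hdiv, hdiv]; ring

/-! ### A positive semidefinite Cauchy kernel -/

-- The kernel is the Gram matrix of the functions `t ^ (c i - 1 / 2)` on the unit interval; the
-- bound on `c` keeps them continuous at `0`. A finite-dimensional factorization then replaces the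
-- functions by vectors.
open scoped MatrixOrder in
theorem exists_sum_mul_eq_inv_add {ι : Type*} [Fintype ι] (c : ι → ℝ) (hc : ∀ i, 1 / 2 ≤ c i) :
    ∃ E : ι → ι → ℝ, ∀ i j, ∑ k, E i k * E j k = 1 / (c i + c j) := by
  classical
  let G : Matrix ι ι ℝ := Matrix.of fun i j => 1 / (c i + c j)
  have hcont : ∀ i, Continuous fun t : ℝ => t ^ (c i - 1 / 2) := fun i =>
    Real.continuous_rpow_const (by linarith [hc i])
  have hG : ∀ i j, ∫ t in (0 : ℝ)..1, t ^ (c i - 1 / 2) * t ^ (c j - 1 / 2) = 1 / (c i + c j) := by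
    intro i j
    have : ∫ t in (0 : ℝ)..1, t ^ (c i - 1 / 2) * t ^ (c j - 1 / 2) =
        ∫ t in (0 : ℝ)..1, t ^ (c i + c j - 1) := by
      refine intervalIntegral.integral_congr_ae (Filter.Eventually.of_forall fun t ht => ?_)
      rw [Set.uIoc_of_le zero_le_one] at ht
      rw [← Real.rpow_add ht.1]
      congr 1; ring
    rw [this, integral_rpow (Or.inl (by linarith [hc i, hc j])),
      Real.zero_rpow (by linarith [hc i, hc j]), Real.one_rpow]
    simp
  have hpsd : G.PosSemidef := by
    refine Matrix.PosSemidef.of_dotProduct_mulVec_nonneg ?_ fun z => ?_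
    · ext i j
      simp [G, add_comm]
    · have : star z ⬝ᵥ G.mulVec z =
          ∫ t in (0 : ℝ)..1, (∑ i, z i * t ^ (c i - 1 / 2)) ^ 2 := by
        simp only [sq, Finset.sum_mul_sum]
        rw [intervalIntegral.integral_finsetSum]
        · simp only [dotProduct, Matrix.mulVec, Finset.mul_sum]
          refine Finset.sum_congr rfl fun i _ => ?_
          rw [intervalIntegral.integral_finsetSum]
          · refine Finset.sum_congr rfl fun j _ => ?_
            have : ∀ t : ℝ, z i * t ^ (c i - 1 / 2) * (z j * t ^ (c j - 1 / 2)) =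
                z i * z j * (t ^ (c i - 1 / 2) * t ^ (c j - 1 / 2)) := fun t => by ring
            simp only [this, intervalIntegral.integral_const_mul, hG, G]
            simp only [Matrix.of_apply, Pi.star_apply, star_trivial]
            ring
          · intro j _
            exact ((continuous_const.mul (hcont i)).mul
              (continuous_const.mul (hcont j))).intervalIntegrable _ _
        · intro i _
          exact (continuous_finsetSum _ fun j _ => (continuous_const.mul (hcont i)).mul
              (continuous_const.mul (hcont j))).intervalIntegrable _ _
      rw [this]
      exact intervalIntegral.integral_nonneg zero_le_one fun t _ => sq_nonneg _
  obtain ⟨B, hB⟩ := CStarAlgebra.nonneg_iff_eq_star_mul_self.1 hpsd.nonneg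
  refine ⟨fun i k => B k i, fun i j => ?_⟩
  have := congrFun (congrFun hB i) j
  simpa [G, Matrix.mul_apply, Matrix.star_apply] using this.symm

/-! ### Random subsets, collisions and agreement of inputs -/

section Subsets

variable {n : ℕ} {Y : Type}

/-- The probability of `A` when every element of `Fin n` is included independently with
probability `p`. -/
noncomputable def subsetWeight (p : ℝ) (A : Finset (Fin n)) : ℝ :=
  p ^ A.card * (1 - p) ^ (n - A.card)

theorem subsetWeight_nonneg {p : ℝ} (h0 : 0 ≤ p) (h1 : p ≤ 1) (A : Finset (Fin n)) :
    0 ≤ subsetWeight p A :=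
  mul_nonneg (pow_nonneg h0 _) (pow_nonneg (sub_nonneg.2 h1) _)

theorem sum_subsetWeight (p : ℝ) : ∑ A : Finset (Fin n), subsetWeight p A = 1 := by
  have := Fintype.sum_pow_mul_eq_add_pow (Fin n) p (1 - p)
  simpa [subsetWeight] using this

/-- Pair each `A` avoiding `i` with `insert i A`: the two weights have ratio `(1 - p) : p`. This
change of measure turns a set enlarged by `i` into a random set that happens to contain `i`. -/
theorem mul_sum_subsetWeight_insert (p : ℝ) (i : Fin n) (h : Finset (Fin n) → ℝ) :
    p * ∑ A, subsetWeight p A * h (insert i A) =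
      ∑ A, if i ∈ A then subsetWeight p A * h A else 0 := by
  have hsum : ∀ F : Finset (Fin n) → ℝ, ∑ A, F A =
      ∑ A ∈ (Finset.univ.erase i).powerset, (F A + F (insert i A)) := by
    intro F
    rw [Finset.sum_add_distrib, ← Finset.sum_powerset_insert (Finset.notMem_erase i _),
      Finset.insert_erase (Finset.mem_univ i), Finset.powerset_univ]
  rw [hsum, hsum, Finset.mul_sum]
  refine Finset.sum_congr rfl fun A hA => ?_
  have hi : i ∉ A := fun h => by simpa using Finset.mem_powerset.1 hA h
  have hcard : A.card + 1 ≤ n := by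
    simpa [Finset.card_insert_of_notMem hi] using Finset.card_le_univ (insert i A)
  have hw : subsetWeight p A * p = subsetWeight p (insert i A) * (1 - p) := by
    unfold subsetWeight
    rw [Finset.card_insert_of_notMem hi]
    have h1 : n - A.card = n - (A.card + 1) + 1 := by omega
    rw [h1]; ring
  simp only [hi, if_false, Finset.insert_idem, Finset.mem_insert_self, if_true]
  linear_combination h (insert i A) * hw

theorem sum_subsetWeight_mem (p : ℝ) (i : Fin n) :
    (∑ A : Finset (Fin n), if i ∈ A then subsetWeight p A else 0) = p := by
  have := mul_sum_subsetWeight_insert p i fun _ => 1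
  simpa [sum_subsetWeight] using this.symm

theorem sum_subsetWeight_mem_mem (p : ℝ) {i j : Fin n} (hij : i ≠ j) :
    (∑ A : Finset (Fin n), if i ∈ A then subsetWeight p A * (if j ∈ A then 1 else 0) else 0) =
      p * p := by
  have := mul_sum_subsetWeight_insert p i fun A => if j ∈ A then 1 else 0
  rw [← this]
  simp only [Finset.mem_insert, hij.symm, false_or, mul_ite, mul_one, mul_zero,
    sum_subsetWeight_mem]

open Classical in
/-- The indicator of a collision between two distinct positions. -/
noncomputable def collide (x : Fin n → Y) (i j : Fin n) : ℝ :=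
  if i ≠ j ∧ x i = x j then 1 else 0

open Classical in
theorem collide_comm (x : Fin n → Y) (i j : Fin n) : collide x i j = collide x j i :=
  if_congr (by rw [ne_comm, eq_comm (a := x i)]) rfl rfl

theorem collide_nonneg (x : Fin n → Y) (i j : Fin n) : 0 ≤ collide x i j := by
  unfold collide; split_ifs <;> simp

theorem collide_mul_self (x : Fin n → Y) (i j : Fin n) :
    collide x i j * collide x i j = collide x i j := by
  unfold collide; split_ifs <;> simp

/-- The number of positions that collide with `j`. -/
noncomputable def collisionDegree (x : Fin n → Y) (j : Fin n) : ℝ :=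
  ∑ i, collide x i j

/-- The number of positions in `A` that collide with `j`. -/
noncomputable def collisionDegreeIn (x : Fin n → Y) (A : Finset (Fin n)) (j : Fin n) : ℝ :=
  ∑ i, if i ∈ A then collide x i j else 0

/-- The number of ordered pairs of colliding positions. -/
noncomputable def collisionCount (x : Fin n → Y) : ℝ :=
  ∑ j, collisionDegree x j

theorem collisionDegree_nonneg (x : Fin n → Y) (j : Fin n) : 0 ≤ collisionDegree x j :=
  Finset.sum_nonneg fun _ _ => collide_nonneg x _ _

theorem collisionCount_nonneg (x : Fin n → Y) : 0 ≤ collisionCount x :=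
  Finset.sum_nonneg fun _ _ => collisionDegree_nonneg x _

theorem collide_le_collisionCount (x : Fin n → Y) (i j : Fin n) :
    collide x i j ≤ collisionCount x :=
  (Finset.single_le_sum (f := fun i => collide x i j) (fun _ _ => collide_nonneg x _ _)
    (Finset.mem_univ i)).trans
    (Finset.single_le_sum (f := fun j => collisionDegree x j)
      (fun _ _ => collisionDegree_nonneg x _) (Finset.mem_univ j))

theorem collide_eq_zero_of_collisionCount {x : Fin n → Y} (hx : collisionCount x = 0)
    (i j : Fin n) : collide x i j = 0 :=
  le_antisymm (hx ▸ collide_le_collisionCount x i j) (collide_nonneg x i j)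

theorem one_le_collisionCount {x : Fin n → Y} (hx : collisionCount x ≠ 0) :
    1 ≤ collisionCount x := by
  by_contra hlt
  refine hx (Finset.sum_eq_zero fun j _ => Finset.sum_eq_zero fun i _ => ?_)
  have := collide_le_collisionCount x i j
  unfold collide at this ⊢
  split_ifs at this ⊢
  · exact absurd this hlt
  · rfl

-- Colliding positions have equal degree, so the square of the degree of `j` is the sum of the
-- degrees over the positions colliding with `j`, a part of the total count.
open Classical in
theorem collisionDegree_sq_le (x : Fin n → Y) (j : Fin n) :
    collisionDegree x j ^ 2 ≤ collisionCount x := by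
  have h : collisionDegree x j ^ 2 = ∑ i, collide x i j * collisionDegree x i := by
    rw [sq]
    nth_rewrite 1 [collisionDegree]
    rw [Finset.sum_mul]
    refine Finset.sum_congr rfl fun i _ => ?_
    by_cases hij : i ≠ j ∧ x i = x j
    · congr 1
      have hcount : ∀ k, collisionDegree x k =
          (∑ l, if x l = x k then 1 else 0) - (1 : ℝ) := by
        intro k
        have : ∀ l, collide x l k = (if x l = x k then 1 else 0) - if l = k then (1 : ℝ) else 0 := by
          intro l
          unfold collide
          by_cases hl : l = k
          · simp [hl]
          · simp [hl]
        simp [collisionDegree, this, Finset.sum_sub_distrib]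
      rw [hcount, hcount, hij.2]
    · simp [collide, hij]
  rw [h]
  refine Finset.sum_le_sum fun i _ => ?_
  refine mul_le_of_le_one_left (collisionDegree_nonneg x i) ?_
  unfold collide; split_ifs <;> simp

theorem sum_collisionDegree_sq_le (x : Fin n → Y) :
    ∑ j, collisionDegree x j ^ 2 ≤ √(collisionCount x) * collisionCount x := by
  rw [collisionCount, Finset.mul_sum]
  refine Finset.sum_le_sum fun j _ => ?_
  rw [sq]
  exact mul_le_mul_of_nonneg_right (Real.le_sqrt_of_sq_le (collisionDegree_sq_le x j))
    (collisionDegree_nonneg x j)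

/-- In the expanded square, equal indices occur with probability `p` and distinct ones with
probability `p ^ 2`. -/
theorem sum_subsetWeight_mul_collisionDegreeIn_sq_le (p : ℝ) (x : Fin n → Y)
    (j : Fin n) :
    ∑ A, subsetWeight p A * collisionDegreeIn x A j ^ 2 ≤
      p * collisionDegree x j + p ^ 2 * collisionDegree x j ^ 2 := by
  have h : ∑ A, subsetWeight p A * collisionDegreeIn x A j ^ 2 =
      ∑ i, ∑ k, collide x i j * collide x k j * ∑ A : Finset (Fin n),
        if i ∈ A then subsetWeight p A * (if k ∈ A then 1 else 0) else 0 := by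
    simp only [collisionDegreeIn, sq, Finset.sum_mul_sum]
    simp only [Finset.mul_sum]
    rw [Finset.sum_comm]
    refine Finset.sum_congr rfl fun i _ => ?_
    rw [Finset.sum_comm]
    refine Finset.sum_congr rfl fun k _ => Finset.sum_congr rfl fun A _ => ?_
    split_ifs <;> ring
  have h2 : p * collisionDegree x j + p ^ 2 * collisionDegree x j ^ 2 =
      ∑ i, ∑ k, ((if i = k then p * collide x i j else 0) +
        p ^ 2 * (collide x i j * collide x k j)) := by
    simp only [Finset.sum_add_distrib, Finset.sum_ite_eq, Finset.mem_univ, if_true,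
      collisionDegree, sq, Finset.sum_mul_sum]
    simp only [Finset.mul_sum]
  rw [h, h2]
  refine Finset.sum_le_sum fun i _ => Finset.sum_le_sum fun k _ => ?_
  by_cases hik : i = k
  · subst hik
    have : (∑ A : Finset (Fin n),
        if i ∈ A then subsetWeight p A * (if i ∈ A then 1 else 0) else 0) = p := by
      conv_rhs => rw [← sum_subsetWeight_mem p i]
      refine Finset.sum_congr rfl fun A _ => ?_
      split_ifs <;> simp
    rw [this, collide_mul_self, if_pos rfl]
    nlinarith [collide_nonneg x i j, mul_nonneg (sq_nonneg p) (collide_nonneg x i j)]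
  · rw [sum_subsetWeight_mem_mem p hik, if_neg hik]
    exact le_of_eq (by ring)

open Classical in
/-- The indicator of agreement of two functions on `A`. -/
noncomputable def agree (A : Finset (Fin n)) (x y : Fin n → Y) : ℝ :=
  if ∀ i ∈ A, x i = y i then 1 else 0

open Classical in
theorem agree_comm (A : Finset (Fin n)) (x y : Fin n → Y) : agree A x y = agree A y x :=
  if_congr (forall₂_congr fun _ _ => eq_comm) rfl rfl

theorem agree_self (A : Finset (Fin n)) (x : Fin n → Y) : agree A x x = 1 := by simp [agree]

open Classical in
theorem agree_insert (A : Finset (Fin n)) (i : Fin n) (x y : Fin n → Y) :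
    agree (insert i A) x y = if x i = y i then agree A x y else 0 := by
  simp only [agree, Finset.forall_mem_insert]
  split_ifs <;> simp_all

-- If the inputs disagree on `A`, exactly one summand survives: that of the first disagreement in
-- increasing order.
open Classical in
theorem sum_agree_lt (A : Finset (Fin n)) (x y : Fin n → Y) :
    (∑ j ∈ A, if x j = y j then 0 else agree (A.filter (· < j)) x y) = 1 - agree A x y := by
  induction A using Finset.induction_on_max with
  | empty => simp [agree]
  | insert a s hs ih =>
    have ha : a ∉ s := fun h => lt_irrefl _ (hs a h)
    rw [Finset.sum_insert ha, agree_insert]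
    have h1 : (insert a s).filter (· < a) = s := by
      ext i
      simp only [Finset.mem_filter, Finset.mem_insert]
      exact ⟨fun h => h.1.resolve_left h.2.ne, fun h => ⟨Or.inr h, hs i h⟩⟩
    have h2 : ∀ j ∈ s, (insert a s).filter (· < j) = s.filter (· < j) := by
      intro j hj
      ext i
      simp only [Finset.mem_filter, Finset.mem_insert]
      exact ⟨fun h => ⟨h.1.resolve_left fun e => lt_asymm h.2 (e ▸ hs j hj), h.2⟩,
        fun h => ⟨Or.inr h.1, h.2⟩⟩
    rw [h1, Finset.sum_congr rfl fun j hj => by rw [h2 j hj], ih]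
    split_ifs <;> ring

-- For each collision `(i, j)` of `x`, querying `i` and then `j` telescopes from agreement on `A` to
-- agreement on `A ∪ {i, j}`; in the latter case `y` collides at `(i, j)` too. The second stage runs
-- on `insert i A`, and the change of measure turns this into `collisionDegreeIn` divided by `p`.
open Classical in
theorem sum_loading_eq (p : ℝ) (hp : p ≠ 0) (x y : Fin n → Y) :
    (∑ j, if x j = y j then 0 else
      (∑ A, subsetWeight p A * collisionDegree x j * agree A x y +
        ∑ A, subsetWeight p A * (collisionDegreeIn x A j / p) * agree A x y)) =
      collisionCount x * ∑ A, subsetWeight p A * agree A x y -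
        ∑ A, ∑ i, ∑ j, subsetWeight p A * (collide x i j * collide y i j *
          agree (insert j (insert i A)) x y) := by
  have h3 : ∀ j, ∑ A, subsetWeight p A * (collisionDegreeIn x A j / p) * agree A x y =
      ∑ A, ∑ i, subsetWeight p A * collide x i j * agree (insert i A) x y := by
    intro j
    have : ∀ i, ∑ A, subsetWeight p A * collide x i j * agree (insert i A) x y =
        p⁻¹ * ∑ A, if i ∈ A then subsetWeight p A * (collide x i j * agree A x y) else 0 := by
      intro i
      rw [← mul_sum_subsetWeight_insert p i fun A => collide x i j * agree A x y, ← mul_assoc,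
        inv_mul_cancel₀ hp, one_mul]
      exact Finset.sum_congr rfl fun A _ => by ring
    rw [Finset.sum_comm]
    simp only [this, Finset.mul_sum]
    rw [Finset.sum_comm]
    refine Finset.sum_congr rfl fun A _ => ?_
    simp only [collisionDegreeIn, Finset.sum_div, Finset.mul_sum, Finset.sum_mul]
    refine Finset.sum_congr rfl fun i _ => ?_
    split_ifs
    · field_simp
    · simp
  have hA : ∀ j, (if x j = y j then 0 else
      (∑ A, subsetWeight p A * collisionDegree x j * agree A x y +
        ∑ A, subsetWeight p A * (collisionDegreeIn x A j / p) * agree A x y)) =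
      ∑ A, ∑ i, (subsetWeight p A * (if x j = y j then 0 else collide x i j * agree A x y) +
        subsetWeight p A * (if x j = y j then 0 else collide x i j * agree (insert i A) x y)) := by
    intro j
    split_ifs
    · simp
    · rw [h3, ← Finset.sum_add_distrib]
      refine Finset.sum_congr rfl fun A _ => ?_
      rw [Finset.sum_add_distrib]
      congr 1
      · simp only [collisionDegree, Finset.mul_sum, Finset.sum_mul, mul_assoc]
      · simp only [mul_assoc]
  simp only [hA]
  rw [Finset.sum_comm, Finset.mul_sum, ← Finset.sum_sub_distrib]
  refine Finset.sum_congr rfl fun A _ => ?_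
  simp only [Finset.sum_add_distrib]
  -- Exchanging the indices in the first stage alone makes `i` its queried position, while `j`
  -- remains that of the second stage.
  nth_rewrite 1 [Finset.sum_comm]
  simp only [collisionCount, collisionDegree, Finset.sum_mul]
  rw [Finset.sum_comm (s := Finset.univ) (t := Finset.univ)
    (f := fun i j => subsetWeight p A * (collide x i j * collide y i j *
          agree (insert j (insert i A)) x y)), ← Finset.sum_sub_distrib, ← Finset.sum_add_distrib]
  refine Finset.sum_congr rfl fun j _ => ?_
  rw [← Finset.sum_sub_distrib, ← Finset.sum_add_distrib]
  refine Finset.sum_congr rfl fun i _ => ?_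
  rw [collide_comm x j i]
  simp only [agree_insert]
  by_cases hx : i ≠ j ∧ x i = x j
  · have hc : collide x i j = 1 := if_pos hx
    by_cases hi : x i = y i
    · by_cases hj : x j = y j
      · have hc' : collide y i j = 1 := if_pos ⟨hx.1, by rw [← hi, ← hj, hx.2]⟩
        simp only [hc, hc', if_pos hi, if_pos hj]
        ring
      · simp only [hc, if_pos hi, if_neg hj]
        ring
    · simp only [if_neg hi]
      split_ifs <;> ring
  · have hc : collide x i j = 0 := if_neg hx
    simp [hc]

open Classical in
theorem sum_loading_prefix (h : Finset (Fin n) → ℝ) (x y : Fin n → Y) :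
    (∑ j, if x j = y j then 0 else
      (∑ A, if j ∈ A then h A * agree (A.filter (· < j)) x y else 0)) =
      ∑ A, h A - ∑ A, h A * agree A x y := by
  have hA : ∀ A, h A - h A * agree A x y = ∑ j, if x j = y j then 0 else
      (if j ∈ A then h A * agree (A.filter (· < j)) x y else 0) := by
    intro A
    have hsum : (∑ j, if x j = y j then 0 else
        (if j ∈ A then h A * agree (A.filter (· < j)) x y else 0)) =
        ∑ j, if j ∈ A then h A * (if x j = y j then 0 else agree (A.filter (· < j)) x y) else 0 :=
      Finset.sum_congr rfl fun j _ => by split_ifs <;> simp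
    rw [hsum, Finset.sum_ite_mem, Finset.univ_inter, ← Finset.mul_sum, sum_agree_lt]
    ring
  rw [← Finset.sum_sub_distrib, Finset.sum_congr rfl fun A _ => hA A, Finset.sum_comm]
  refine Finset.sum_congr rfl fun j _ => ?_
  split_ifs <;> simp

end Subsets

/-! ### Target states and adversary vectors -/

section Construction

variable {n : ℕ} {Y : Type} [AddCommGroup Y]

/-- The function that agrees with `x` on `A` and vanishes elsewhere. -/
def maskOn (A : Finset (Fin n)) (x : Fin n → Y) : Fin n → Y :=
  fun i => if i ∈ A then x i else 0

theorem maskOn_eq_iff (A : Finset (Fin n)) (x y : Fin n → Y) :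
    maskOn A x = maskOn A y ↔ ∀ i ∈ A, x i = y i := by
  constructor
  · intro h i hi
    simpa [maskOn, hi] using congrFun h i
  · intro h
    funext i
    by_cases hi : i ∈ A
    · simpa [maskOn, hi] using h i hi
    · simp [maskOn, hi]

open Classical in
/-- The indicator of the basis state that records the restriction of `x` to `A`. -/
noncomputable def recordOn (A : Finset (Fin n)) (x g : Fin n → Y) : ℝ :=
  if g = maskOn A x then 1 else 0

theorem sum_recordOn_mul [Fintype Y] (A : Finset (Fin n)) (x y : Fin n → Y) (r s : ℝ) :
    ∑ g, r * recordOn A x g * (s * recordOn A y g) = r * s * agree A x y := by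
  classical
  rw [Finset.sum_eq_single (maskOn A x)]
  · by_cases h : ∀ i ∈ A, x i = y i
    · simp [recordOn, agree, if_pos h, (maskOn_eq_iff A x y).2 h]
    · simp [recordOn, agree, h, mt (maskOn_eq_iff A x y).1 h]
  · intro g _ hg
    simp [recordOn, hg]
  · simp

theorem sum_recordOn_sq [Fintype Y] (A : Finset (Fin n)) (x : Fin n → Y) (r : ℝ) :
    ∑ g, (r * recordOn A x g) ^ 2 = r ^ 2 := by
  simp only [sq, sum_recordOn_mul, agree_self, mul_one]

open Classical in
/-- The state of the output register: the colliding pairs, together with a random set of recorded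
positions, or only the latter if there is no collision. -/
noncomputable def targetState (p : ℝ) (x : Fin n → Y) :
    Option (Fin n × Fin n) × Finset (Fin n) × (Fin n → Y) → ℝ
  | (none, A, g) => (if collisionCount x = 0 then √(subsetWeight p A) else 0) * recordOn A x g
  | (some (i, j), A, g) => (√(subsetWeight p A) * collide x i j / √(collisionCount x)) *
      recordOn (insert j (insert i A)) x g

theorem sum_targetState_mul [Fintype Y] {p : ℝ} (h0 : 0 ≤ p) (h1 : p ≤ 1) (x y : Fin n → Y) :
    ∑ s, targetState p x s * targetState p y s =
      (if collisionCount x = 0 ∧ collisionCount y = 0 then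
        ∑ A, subsetWeight p A * agree A x y else 0) +
      (∑ A, ∑ i, ∑ j, subsetWeight p A * (collide x i j * collide y i j *
          agree (insert j (insert i A)) x y)) / (√(collisionCount x) * √(collisionCount y)) := by
  have hw : ∀ A : Finset (Fin n), √(subsetWeight p A) * √(subsetWeight p A) = subsetWeight p A :=
    fun A => Real.mul_self_sqrt (subsetWeight_nonneg h0 h1 A)
  simp only [Fintype.sum_prod_type, Fintype.sum_option, targetState, sum_recordOn_mul]
  congr 1
  · split_ifs with hx hy hxy hxy hy hxy
    · exact Finset.sum_congr rfl fun A _ => by rw [hw]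
    all_goals simp_all
  · have : ∀ i j : Fin n, ∀ A : Finset (Fin n),
        √(subsetWeight p A) * collide x i j / √(collisionCount x) *
          (√(subsetWeight p A) * collide y i j / √(collisionCount y)) *
          agree (insert j (insert i A)) x y =
        subsetWeight p A * (collide x i j * collide y i j *
          agree (insert j (insert i A)) x y) / (√(collisionCount x) * √(collisionCount y)) := by
      intro i j A
      conv_rhs => rw [← hw A]
      simp only [div_eq_mul_inv, mul_inv]
      ring
    simp only [this, ← Finset.sum_div]
    congr 1
    conv_rhs => rw [Finset.sum_comm]
    exact Finset.sum_congr rfl fun i _ => Finset.sum_comm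

/-- The vectors of the adversary bound that depend on the collisions. The left summand loads a
random set in increasing order; the right one adds a colliding pair, in two stages. -/
noncomputable def collisionVec {ι : Type} (p : ℝ) (α : (Fin n → Y) → ι → ℝ) (x : Fin n → Y)
    (j : Fin n) : (Finset (Fin n) × (Fin n → Y)) ⊕ (Bool × ι × Finset (Fin n) × (Fin n → Y)) → ℝ
  | Sum.inl (A, g) => (if j ∈ A then √(subsetWeight p A / 2) else 0) *
      recordOn (A.filter (· < j)) x g
  | Sum.inr (false, k, A, g) => (α x k * (collisionDegree x j * √(subsetWeight p A) /
      (collisionCount x * √p))) * recordOn A x g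
  | Sum.inr (true, k, A, g) => (α x k * (collisionDegreeIn x A j * √(subsetWeight p A) /
      (collisionCount x * (p * √p)))) * recordOn A x g

/-- The vectors of the adversary bound dual to `collisionVec`. -/
noncomputable def weightVec {ι : Type} (p : ℝ) (β : (Fin n → Y) → ι → ℝ) (x : Fin n → Y)
    (j : Fin n) : (Finset (Fin n) × (Fin n → Y)) ⊕ (Bool × ι × Finset (Fin n) × (Fin n → Y)) → ℝ
  | Sum.inl (A, g) => (if j ∈ A then √(subsetWeight p A / 2) else 0) *
      recordOn (A.filter (· < j)) x g
  | Sum.inr (_, k, A, g) => (β x k * (√p * √(subsetWeight p A))) * recordOn A x g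

variable [Fintype Y] {ι : Type} [Fintype ι] {p : ℝ}

/-- The powers of `√p` cancel in the product up to the `1 / p` of the second stage; they serve to
give the right summand of `weightVec` squared norm of order `n * p`. -/
theorem sum_collisionVec_mul_weightVec (h0 : 0 < p) (h1 : p ≤ 1)
    (α β : (Fin n → Y) → ι → ℝ) (x y : Fin n → Y) (j : Fin n) :
    ∑ d, collisionVec p α x j d * weightVec p β y j d =
      (∑ A, if j ∈ A then subsetWeight p A * agree (A.filter (· < j)) x y else 0) / 2 +
      (∑ k, α x k * β y k) / collisionCount x *
        (∑ A, subsetWeight p A * collisionDegree x j * agree A x y +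
          ∑ A, subsetWeight p A * (collisionDegreeIn x A j / p) * agree A x y) := by
  have hw : ∀ A : Finset (Fin n), √(subsetWeight p A) ^ 2 = subsetWeight p A :=
    fun A => Real.sq_sqrt (subsetWeight_nonneg h0.le h1 A)
  have hw2 : ∀ A : Finset (Fin n), √(subsetWeight p A / 2) ^ 2 = subsetWeight p A / 2 :=
    fun A => Real.sq_sqrt (div_nonneg (subsetWeight_nonneg h0.le h1 A) zero_le_two)
  have hp : √p ≠ 0 := (Real.sqrt_pos.2 h0).ne'
  have e1 : ∀ k A, α x k * (collisionDegree x j * √(subsetWeight p A) /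
      (collisionCount x * √p)) * (β y k * (√p * √(subsetWeight p A))) * agree A x y =
      α x k * β y k * ((subsetWeight p A * collisionDegree x j * agree A x y) /
        collisionCount x) := by
    intro k A
    conv_rhs => rw [← hw A]
    field_simp
  have e2 : ∀ k A, α x k * (collisionDegreeIn x A j * √(subsetWeight p A) /
      (collisionCount x * (p * √p))) * (β y k * (√p * √(subsetWeight p A))) * agree A x y =
      α x k * β y k * ((subsetWeight p A * (collisionDegreeIn x A j / p) * agree A x y) /
        collisionCount x) := by
    intro k A
    conv_rhs => rw [← hw A]
    field_simp
  simp only [Fintype.sum_prod_type, Fintype.sum_sum_type, Fintype.sum_bool, collisionVec,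
    weightVec, sum_recordOn_mul]
  congr 1
  · rw [Finset.sum_div]
    refine Finset.sum_congr rfl fun A _ => ?_
    split_ifs
    · rw [← sq, hw2]; ring
    · simp
  · simp only [e1, e2, ← Finset.mul_sum, ← Finset.sum_mul, ← Finset.sum_div]
    ring

open Classical in
theorem sum_ite_collisionVec_mul_weightVec (h0 : 0 < p) (h1 : p ≤ 1)
    (α β : (Fin n → Y) → ι → ℝ) (x y : Fin n → Y) :
    (∑ j, if x j = y j then 0 else ∑ d, collisionVec p α x j d * weightVec p β y j d) =
      (1 - ∑ A, subsetWeight p A * agree A x y) / 2 +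
      (∑ k, α x k * β y k) / collisionCount x *
        (collisionCount x * ∑ A, subsetWeight p A * agree A x y -
        ∑ A, ∑ i, ∑ j, subsetWeight p A * (collide x i j * collide y i j *
          agree (insert j (insert i A)) x y)) := by
  rw [← sum_loading_eq p h0.ne', ← sum_subsetWeight (n := n) p,
    ← sum_loading_prefix (subsetWeight p) x y, Finset.sum_div, Finset.mul_sum,
    ← Finset.sum_add_distrib]
  refine Finset.sum_congr rfl fun j _ => ?_
  rw [sum_collisionVec_mul_weightVec h0 h1]
  split_ifs
  · simp
  · rfl

theorem sum_sum_ite_mem (p : ℝ) :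
    (∑ j : Fin n, ∑ A : Finset (Fin n), if j ∈ A then subsetWeight p A else 0) = n * p := by
  simp [sum_subsetWeight_mem]

theorem sum_weightVec_sq (h0 : 0 < p) (h1 : p ≤ 1) (β : (Fin n → Y) → ι → ℝ) (x : Fin n → Y) :
    ∑ j, ∑ d, weightVec p β x j d ^ 2 = n * p / 2 + 2 * (n * p) * ∑ k, β x k ^ 2 := by
  have hw : ∀ A : Finset (Fin n), √(subsetWeight p A) ^ 2 = subsetWeight p A :=
    fun A => Real.sq_sqrt (subsetWeight_nonneg h0.le h1 A)
  have hw2 : ∀ A : Finset (Fin n), √(subsetWeight p A / 2) ^ 2 = subsetWeight p A / 2 :=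
    fun A => Real.sq_sqrt (div_nonneg (subsetWeight_nonneg h0.le h1 A) zero_le_two)
  have e : ∀ k (A : Finset (Fin n)), (β x k * (√p * √(subsetWeight p A))) ^ 2 =
      β x k ^ 2 * (p * subsetWeight p A) := by
    intro k A
    rw [mul_pow, mul_pow, hw, Real.sq_sqrt h0.le]
  have e0 : ∀ (j : Fin n) (A : Finset (Fin n)), (if j ∈ A then √(subsetWeight p A / 2) else 0) ^ 2 =
      (if j ∈ A then subsetWeight p A else 0) / 2 := by
    intro j A
    split_ifs
    · rw [hw2]
    · simp
  simp only [Fintype.sum_prod_type, Fintype.sum_sum_type,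
    Fintype.sum_bool, weightVec, sum_recordOn_sq, e, e0, ← Finset.mul_sum,
    ← Finset.sum_mul, ← Finset.sum_div, sum_subsetWeight, Finset.sum_add_distrib, sum_sum_ite_mem]
  simp
  ring

/-- The factor `√N` allowed for `α` is absorbed, since the sum of the squared degrees is at most `N
* √N`. The first stage then costs `1 / p`, the second `1 / p + 1 / (p ^ 2 * √N)`. -/
theorem sum_collisionVec_sq_le (h0 : 0 < p) (h1 : p ≤ 1) (α : (Fin n → Y) → ι → ℝ)
    (x : Fin n → Y) (hα : ∑ k, α x k ^ 2 ≤ √(collisionCount x)) :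
    ∑ j, ∑ d, collisionVec p α x j d ^ 2 ≤ n * p / 2 + (2 / p + 1 / p ^ 2) := by
  have hw : ∀ A : Finset (Fin n), √(subsetWeight p A) ^ 2 = subsetWeight p A :=
    fun A => Real.sq_sqrt (subsetWeight_nonneg h0.le h1 A)
  have hw2 : ∀ A : Finset (Fin n), √(subsetWeight p A / 2) ^ 2 = subsetWeight p A / 2 :=
    fun A => Real.sq_sqrt (div_nonneg (subsetWeight_nonneg h0.le h1 A) zero_le_two)
  have hp : √p ^ 2 = p := Real.sq_sqrt h0.le
  have e1 : ∀ k j (A : Finset (Fin n)), (α x k * (collisionDegree x j * √(subsetWeight p A) /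
      (collisionCount x * √p))) ^ 2 =
      α x k ^ 2 * (subsetWeight p A * (collisionDegree x j ^ 2 / (collisionCount x ^ 2 * p))) := by
    intro k j A
    rw [mul_pow, div_pow, mul_pow, mul_pow, hw, hp]
    ring
  have e2 : ∀ k j (A : Finset (Fin n)), (α x k * (collisionDegreeIn x A j * √(subsetWeight p A) /
      (collisionCount x * (p * √p)))) ^ 2 =
      α x k ^ 2 * (subsetWeight p A * collisionDegreeIn x A j ^ 2 /
        (collisionCount x ^ 2 * p ^ 3)) := by
    intro k j A
    rw [mul_pow, div_pow, mul_pow, mul_pow, mul_pow, hw, hp]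
    ring
  have e0 : ∀ (j : Fin n) (A : Finset (Fin n)), (if j ∈ A then √(subsetWeight p A / 2) else 0) ^ 2 =
      (if j ∈ A then subsetWeight p A else 0) / 2 := by
    intro j A
    split_ifs
    · rw [hw2]
    · simp
  simp only [Fintype.sum_prod_type, Fintype.sum_sum_type,
    Fintype.sum_bool, collisionVec, sum_recordOn_sq, e1, e2, e0,
    ← Finset.mul_sum, ← Finset.sum_mul, ← Finset.sum_div, sum_subsetWeight, one_mul,
    Finset.sum_add_distrib, sum_sum_ite_mem]
  refine add_le_add le_rfl ?_
  set N := collisionCount x with hN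
  have hsq := sum_collisionDegree_sq_le x
  have hin : ∑ j, ∑ A, subsetWeight p A * collisionDegreeIn x A j ^ 2 ≤
      p * N + p ^ 2 * (√N * N) := by
    calc _ ≤ ∑ j, (p * collisionDegree x j + p ^ 2 * collisionDegree x j ^ 2) :=
          Finset.sum_le_sum fun j _ => sum_subsetWeight_mul_collisionDegreeIn_sq_le p x j
      _ = p * N + p ^ 2 * ∑ j, collisionDegree x j ^ 2 := by
          rw [Finset.sum_add_distrib, ← Finset.mul_sum, ← Finset.mul_sum]; rfl
      _ ≤ _ := by gcongr
  have hN0 : 0 ≤ N := collisionCount_nonneg x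
  have hk : 0 ≤ ∑ k, α x k ^ 2 := Finset.sum_nonneg fun _ _ => sq_nonneg _
  rw [← mul_add]
  have hsum : (∑ j, ∑ A, subsetWeight p A * collisionDegreeIn x A j ^ 2) / (N ^ 2 * p ^ 3) +
      (∑ j, collisionDegree x j ^ 2) / (N ^ 2 * p) ≤
      (p * N + p ^ 2 * (√N * N)) / (N ^ 2 * p ^ 3) + √N * N / (N ^ 2 * p) := by
    gcongr
  refine (mul_le_mul hα hsum ?_ (Real.sqrt_nonneg _)).trans ?_
  · refine add_nonneg (div_nonneg (Finset.sum_nonneg fun j _ => Finset.sum_nonneg fun A _ =>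
      mul_nonneg (subsetWeight_nonneg h0.le h1 A) (sq_nonneg _)) (by positivity))
      (div_nonneg (Finset.sum_nonneg fun j _ => sq_nonneg _) (by positivity))
  by_cases hz : N = 0
  · rw [hz]; simp; positivity
  · have hone : 1 ≤ N := one_le_collisionCount hz
    have ha : 1 ≤ √N := Real.one_le_sqrt.2 hone
    obtain ⟨a, haN⟩ : ∃ a, a = √N := ⟨_, rfl⟩
    have hNa : N = a ^ 2 := by rw [haN, Real.sq_sqrt hN0]
    rw [← haN] at ha ⊢
    rw [hNa]
    have hapos : 0 < a := by linarith
    have : a * ((p * a ^ 2 + p ^ 2 * (a * a ^ 2)) / ((a ^ 2) ^ 2 * p ^ 3) +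
        a * a ^ 2 / ((a ^ 2) ^ 2 * p)) = 2 / p + 1 / p ^ 2 * (1 / a) := by
      field_simp
      ring
    rw [this]
    have : 1 / a ≤ 1 := by rw [div_le_one hapos]; exact ha
    have hp2 : 0 ≤ 1 / p ^ 2 := by positivity
    nlinarith

end Construction

/-! ### Unknown collision counts and the final algorithm -/

theorem isElementDistinctnessAnswer_of_targetState_ne_zero {n : ℕ} {Y : Type} [AddCommGroup Y]
    (p : ℝ) (f : Fin n → Y) (s : Option (Fin n × Fin n) × Finset (Fin n) × (Fin n → Y))
    (hs : targetState p f s ≠ 0) : IsElementDistinctnessAnswer f s.1 := by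
  obtain ⟨_ | ⟨i, j⟩, A, g⟩ := s
  · intro i j hij hf
    refine hs ?_
    have : collisionCount f ≠ 0 := fun h0 => by
      have := collide_eq_zero_of_collisionCount h0 i j
      simp [collide, hij, hf] at this
    simp [targetState, this]
  · by_contra h
    refine hs ?_
    have : collide f i j = 0 := if_neg h
    simp [targetState, this]

open Classical in
/-- Vectors with the cross inner products `a / (a + b)`, where `a ^ 2` and `b ^ 2` are the numbers
of collisions. -/
theorem exists_collisionCount_kernel (n : ℕ) (Y : Type) [Fintype Y] :
    ∃ α β : (Fin n → Y) → (Fin n → Y) × Bool → ℝ,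
      (∀ x y, ∑ k, α x k * β y k =
        √(collisionCount x) / (√(collisionCount x) + √(collisionCount y))) ∧
      (∀ x, ∑ k, α x k ^ 2 ≤ √(collisionCount x)) ∧ ∀ x, ∑ k, β x k ^ 2 ≤ 1 := by
  -- Shifting the square roots by `-1 / 2` and `+1 / 2` preserves their sum, while both entries stay
  -- at least `1 / 2` because a nonzero count is at least `1`. For count zero with `true` the value
  -- is arbitrary, as `α` vanishes there.
  let c : (Fin n → Y) × Bool → ℝ := fun z =>
    if z.2 then (if collisionCount z.1 = 0 then 1 / 2 else √(collisionCount z.1) - 1 / 2)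
    else √(collisionCount z.1) + 1 / 2
  have hone : ∀ x : Fin n → Y, collisionCount x ≠ 0 → 1 ≤ √(collisionCount x) := fun x hx =>
    Real.one_le_sqrt.2 (one_le_collisionCount hx)
  have hc : ∀ z, 1 / 2 ≤ c z := by
    rintro ⟨x, _ | _⟩
    · simp [c]
    · by_cases hx : collisionCount x = 0
      · simp [c, hx]
      · have := hone x hx
        simp only [c, if_true, if_neg hx]
        linarith
  obtain ⟨E, hE⟩ := exists_sum_mul_eq_inv_add c hc
  refine ⟨fun x k => √(collisionCount x) * E (x, true) k, fun x k => E (x, false) k,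
    fun x y => ?_, fun x => ?_, fun x => ?_⟩
  · simp only [mul_assoc, ← Finset.mul_sum, hE]
    by_cases hx : collisionCount x = 0
    · simp [hx]
    · have : c (x, true) + c (y, false) = √(collisionCount x) + √(collisionCount y) := by
        simp [c, hx]
      rw [this, mul_one_div]
  · simp only [mul_pow, ← Finset.mul_sum]
    simp only [sq (E _ _), hE]
    by_cases hx : collisionCount x = 0
    · simp [hx]
    · have h1 := hone x hx
      have : c (x, true) + c (x, true) = 2 * √(collisionCount x) - 1 := by
        simp [c, hx]; ring
      rw [this, mul_one_div, div_le_iff₀ (by linarith)]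
      nlinarith
  · simp only [sq, hE]
    rw [div_le_one (by linarith [hc (x, false)])]
    have : c (x, false) + c (x, false) = 2 * √(collisionCount x) + 1 := by
      simp [c]; ring
    rw [this]
    linarith [Real.sqrt_nonneg (collisionCount x)]

theorem exists_elementDistinctness_algorithm {n : ℕ} (hn : 1 ≤ n) (Y : Type) [AddCommGroup Y]
    [Fintype Y] {p : ℝ} (h0 : 0 < p) (h1 : p ≤ 1) (K : ℕ) (hK : 0 < K) :
    ∃ A : QueryAlgorithm n Y (Option (Fin n × Fin n)), A.queries = K ∧
      SolvesElementDistinctness A (4 * ((3 * (n * p) + 2 / p + 1 / p ^ 2) / K)) := by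
  classical
  obtain ⟨α, β, hαβ, hα, hβ⟩ := exists_collisionCount_kernel n Y
  refine (exists_queryAlgorithm_of_adversary_pair hn none Prod.fst
    (targetState p) (collisionVec p α) (weightVec p β) (3 * (n * p) + 2 / p + 1 / p ^ 2)
    (fun f g => ?_) (fun f => ?_) K hK).imp fun A hA => ⟨hA.1, fun f => hA.2 f _ fun s hs => ?_⟩
  · rw [sum_ite_collisionVec_mul_weightVec h0 h1, sum_ite_collisionVec_mul_weightVec h0 h1,
      sum_targetState_mul h0.le h1, hαβ, hαβ]
    have hR : ∑ A, subsetWeight p A * agree A g f = ∑ A, subsetWeight p A * agree A f g := by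
      simp only [agree_comm _ g f]
    have hM : ∑ A, ∑ i, ∑ j, subsetWeight p A * (collide g i j * collide f i j *
          agree (insert j (insert i A)) g f) = ∑ A, ∑ i, ∑ j, subsetWeight p A *
          (collide f i j * collide g i j * agree (insert j (insert i A)) f g) := by
      simp only [agree_comm _ g f, mul_comm (collide g _ _)]
    rw [hR, hM]
    set R := ∑ A, subsetWeight p A * agree A f g
    set M := ∑ A, ∑ i, ∑ j, subsetWeight p A * (collide f i j * collide g i j *
          agree (insert j (insert i A)) f g) with hMdef
    have hMf : collisionCount f = 0 → M = 0 := fun h => by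
      simp [hMdef, collide_eq_zero_of_collisionCount h]
    have hMg : collisionCount g = 0 → M = 0 := fun h => by
      simp [hMdef, collide_eq_zero_of_collisionCount h]
    have hpos : ∀ x : Fin n → Y, collisionCount x ≠ 0 → 0 < √(collisionCount x) := fun x hx =>
      Real.sqrt_pos.2 (lt_of_lt_of_le one_pos (one_le_collisionCount hx))
    -- If exactly one count is zero, then `M = 0` and the two weights are `0` and `1`, so the
    -- targets are orthogonal. If both are zero, division by zero makes both weights `0`, and `R`
    -- remains.
    by_cases hf : collisionCount f = 0
    · by_cases hg : collisionCount g = 0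
      · simp [hf, hg]
      · have := (hpos g hg).ne'
        simp [hf, hg, hMf hf]
        field_simp
        ring
    · by_cases hg : collisionCount g = 0
      · have := (hpos f hf).ne'
        simp [hf, hg, hMg hg]
        field_simp
        ring
      · have hf' := hpos f hf
        have hg' := hpos g hg
        have ef : collisionCount f = √(collisionCount f) ^ 2 :=
          (Real.sq_sqrt (collisionCount_nonneg f)).symm
        have eg : collisionCount g = √(collisionCount g) ^ 2 :=
          (Real.sq_sqrt (collisionCount_nonneg g)).symm
        rw [if_neg fun h => hf h.1]
        generalize √(collisionCount f) = a at *
        generalize √(collisionCount g) = b at *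
        rw [ef, eg]
        have hab : a + b ≠ 0 := by positivity
        have hba : b + a ≠ 0 := by positivity
        rw [add_comm b a]
        field_simp
        ring
  · have h := sum_collisionVec_sq_le h0 h1 α f (hα f)
    rw [sum_weightVec_sq h0 h1]
    have h2 : 2 * (n * p) * ∑ k, β f k ^ 2 ≤ 2 * (n * p) :=
      mul_le_of_le_one_right (by positivity) (hβ f)
    linarith
  · by_contra h
    exact hs (isElementDistinctnessAnswer_of_targetState_ne_zero p f s h)

theorem theorem5 :
    ∀ ε : ℝ, 0 < ε → ∃ C : ℝ, ∀ n : ℕ, 1 ≤ n →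
      ∀ (Y : Type) [AddCommGroup Y] [Fintype Y],
        ∃ A : QueryAlgorithm n Y (Option (Fin n × Fin n)),
          (A.queries : ℝ) ≤ C * (n : ℝ) ^ (2 / 3 : ℝ) ∧ SolvesElementDistinctness A ε := by
  intro ε hε
  -- With `p = 1 / r` and `r = n ^ (1/3)` the cost is `4 * r ^ 2 + 2 * r ≤ 6 * r ^ 2`; the error
  -- factor `4` gives `24`, and the `1` pays for rounding up.
  refine ⟨24 / ε + 1, fun n hn Y _ _ => ?_⟩
  have hn' : (1 : ℝ) ≤ n := by exact_mod_cast hn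
  obtain ⟨r, hr⟩ : ∃ r : ℝ, r = (n : ℝ) ^ (1 / 3 : ℝ) := ⟨_, rfl⟩
  have hr1 : 1 ≤ r := hr ▸ Real.one_le_rpow hn' (by norm_num)
  have hr0 : 0 < r := by linarith
  have hr2 : (n : ℝ) ^ (2 / 3 : ℝ) = r ^ 2 := by
    rw [hr, ← Real.rpow_natCast, ← Real.rpow_mul (by positivity)]; norm_num
  have hr3 : (n : ℝ) = r ^ 3 := by
    rw [hr, ← Real.rpow_natCast, ← Real.rpow_mul (by positivity)]; norm_num
  have hpos : 0 < 24 * r ^ 2 / ε := by positivity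
  have hK : 0 < ⌈24 * r ^ 2 / ε⌉₊ := Nat.ceil_pos.2 hpos
  obtain ⟨A, hA, hsol⟩ := exists_elementDistinctness_algorithm hn Y (p := 1 / r) (by positivity)
    (by rw [div_le_one hr0]; exact hr1) _ hK
  refine ⟨A, ?_, fun f => le_trans ?_ (hsol f)⟩
  · rw [hA, hr2]
    have h1 := (Nat.ceil_lt_add_one hpos.le).le
    have h2 : (24 / ε + 1) * r ^ 2 = 24 * r ^ 2 / ε + r ^ 2 := by ring
    nlinarith
  · have h1 := Nat.le_ceil (24 * r ^ 2 / ε)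
    have h2 : 3 * ((n : ℝ) * (1 / r)) + 2 / (1 / r) + 1 / (1 / r) ^ 2 ≤ 6 * r ^ 2 := by
      have : 3 * ((n : ℝ) * (1 / r)) + 2 / (1 / r) + 1 / (1 / r) ^ 2 = 4 * r ^ 2 + 2 * r := by
        rw [hr3]; field_simp; ring
      nlinarith
    have hKpos : (0 : ℝ) < ⌈24 * r ^ 2 / ε⌉₊ := by exact_mod_cast hK
    have h3 : 4 * ((3 * ((n : ℝ) * (1 / r)) + 2 / (1 / r) + 1 / (1 / r) ^ 2) /
        ⌈24 * r ^ 2 / ε⌉₊) ≤ ε := by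
      rw [← mul_div_assoc, div_le_iff₀ hKpos]
      rw [div_le_iff₀ hε] at h1
      linarith
    linarith
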